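/- Let $p$ be a prime with $p\neq 2,3,11$. For rational numbers $x,y$ and $m\in\{p,p^2\}$, write $x\equiv y\pmod m$ if $x-y=mz$ for some rational number $z$ whose denominator in lowest terms is not divisible by $p$. Let $$S_p=\sum_{k=0}^{p-1}\frac{\binom{2k}{k}\binom{3k}{k}\binom{6k}{3k}}{66^{3k}}.$$ If $p\equiv 3\pmod 4$, then $S_p\equiv 0\pmod{p^2}$. If $p\equiv 1\pmod 4$ and $p=a^2+b^2$ with integers $a,b$ and $a$ odd, then $S_p\equiv\left(\frac{p}{33}\right)4a^2\pmod p$, where $\left(\frac{\cdot}{33}\right)$ is the Jacobi symbol. -/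

import Mathlib

/-- Congruence of rational numbers modulo a natural number `m`: `x ≡ y (mod m)` means that
`x - y = m * z` for some rational `z` whose denominator (in lowest terms) is coprime to `m`.
For `m` a power of a prime `p`, this is congruence modulo `m` in the ring of rationals
whose denominator is not divisible by `p`. -/
def RatModEq (m : ℕ) (x y : ℚ) : Prop :=
  ∃ z : ℚ, Nat.Coprime z.den m ∧ x - y = (m : ℚ) * z

open Polynomial Finset

/-! Clausen's formula writes the series of `sexticSqCoeff` at `y(1 - 432y)` as the square of the
series of `sexticCoeff` at `y`. Truncated at `p` it still holds modulo `p²`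
(`sum_sexticSqCoeff_eq_sq`): below degree `p` the two polynomials agree, and above it every
coefficient is divisible by `p²`. Solving `y(1 - 432y) = 66⁻³` puts `y` in an extension by `√33`,
taken formally so that it does not matter whether 33 is a square.

Modulo `p`, the truncated series at this `y` is, up to a power of `√33`, the Hasse invariant of `y²
= x³ - 11x + 14` (`coeff_pow_eq_mul_sum`), hence minus a character sum over `ZMod p`. A 2-isogeny
identifies that sum with the Jacobsthal sum `J` of `y² = x³ - x`.

If `p ≡ 3 (mod 4)`, then `J = 0` by oddness, so the truncated series is divisible by `p` and its
square by `p²`. If `p ≡ 1 (mod 4)`, then `J² = 4a²` by Jacobsthal's theorem, and the power of `√33`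
contributes the Jacobi symbol. -/

/-- The coefficients `(6k)! / (k! (2k)! (3k)!)` of the sextic hypergeometric series. -/
def sexticCoeff (k : ℕ) : ℤ := (Nat.choose (3 * k) k : ℤ) * (Nat.choose (6 * k) (3 * k) : ℤ)

/-- The coefficients `(6k)! / (k!³ (3k)!)` of the square of the sextic hypergeometric series. -/
def sexticSqCoeff (k : ℕ) : ℤ :=
  (Nat.choose (2 * k) k : ℤ) * (Nat.choose (3 * k) k : ℤ) * (Nat.choose (6 * k) (3 * k) : ℤ)

/-! ### Recurrences of the two coefficient sequences. -/

theorem sexticSqCoeff_eq (k : ℕ) : sexticSqCoeff k = (Nat.centralBinom k : ℤ) * sexticCoeff k := by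
  simp [sexticSqCoeff, sexticCoeff, Nat.centralBinom, mul_assoc]

theorem sexticCoeff_mul_factorials (k : ℕ) :
    sexticCoeff k * ((k.factorial : ℤ) * (2 * k).factorial * (3 * k).factorial) =
      (6 * k).factorial := by
  have h1 := Nat.choose_mul_factorial_mul_factorial (show k ≤ 3 * k by omega)
  have h2 := Nat.choose_mul_factorial_mul_factorial (show 3 * k ≤ 6 * k by omega)
  rw [show 3 * k - k = 2 * k by omega] at h1
  rw [show 6 * k - 3 * k = 3 * k by omega] at h2
  zify at h1 h2
  unfold sexticCoeff
  linear_combination (((6 * k).choose (3 * k) : ℤ) * (3 * k).factorial) * h1 + h2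

theorem sexticCoeff_succ (k : ℕ) :
    ((k : ℤ) + 1) ^ 2 * sexticCoeff (k + 1) = 12 * (6 * k + 1) * (6 * k + 5) * sexticCoeff k := by
  have h0 := sexticCoeff_mul_factorials k
  have h1 := sexticCoeff_mul_factorials (k + 1)
  rw [show 2 * (k + 1) = 2 * k + 2 by ring, show 3 * (k + 1) = 3 * k + 3 by ring,
    show 6 * (k + 1) = 6 * k + 6 by ring] at h1
  simp only [Nat.factorial_succ, Nat.cast_mul, Nat.cast_add, Nat.cast_one, Nat.cast_ofNat] at h1
  have hne : (((k.factorial : ℤ) * (2 * k).factorial * (3 * k).factorial) *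
      (2 * (2 * k + 1) * (3 * k + 1) * (3 * k + 2) * 3 * (k + 1))) ≠ 0 := by positivity
  refine mul_right_cancel₀ hne ?_
  rw [← h0] at h1
  linear_combination h1

theorem sexticSqCoeff_succ (k : ℕ) :
    ((k : ℤ) + 1) ^ 3 * sexticSqCoeff (k + 1) =
      24 * (2 * k + 1) * (6 * k + 1) * (6 * k + 5) * sexticSqCoeff k := by
  have h := Nat.succ_mul_centralBinom_succ k
  zify at h
  rw [sexticSqCoeff_eq, sexticSqCoeff_eq]
  linear_combination ((k : ℤ) + 1) ^ 2 * sexticCoeff (k + 1) * h +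
    2 * (2 * k + 1) * (Nat.centralBinom k : ℤ) * sexticCoeff_succ k

/-! ### Powers of `p` in the coefficients. -/

section Divisibility

variable {p : ℕ}

theorem Nat.Prime.pow_dvd_of_dvd_pow_mul (hp : p.Prime) {k e i : ℕ} (hk : k + 1 < p) {x : ℤ}
    (h : (p : ℤ) ^ e ∣ ((k : ℤ) + 1) ^ i * x) : (p : ℤ) ^ e ∣ x := by
  have hc : IsCoprime ((p : ℤ) ^ e) (((k : ℤ) + 1) ^ i) := by
    apply IsCoprime.pow
    have : Nat.Coprime p (k + 1) :=
      (Nat.coprime_of_lt_prime (by omega) hk hp)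
    exact_mod_cast Nat.isCoprime_iff_coprime.mpr this
  exact hc.dvd_of_dvd_mul_left h

theorem Nat.Prime.mod_six (hp : p.Prime) (h2 : p ≠ 2) (h3 : p ≠ 3) : p % 6 = 1 ∨ p % 6 = 5 := by
  have a : ¬ 2 ∣ p := fun h => h2 ((Nat.prime_dvd_prime_iff_eq Nat.prime_two hp).1 h).symm
  have b : ¬ 3 ∣ p := fun h => h3 ((Nat.prime_dvd_prime_iff_eq Nat.prime_three hp).1 h).symm
  omega

/-- In the recurrence the factor `6k + 1` or `6k + 5`, according to `p` modulo 6, equals `p` just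
before the threshold; the divisor `(k + 1)²` never removes it while `k + 1 < p`. -/
theorem dvd_sexticCoeff (hp : p.Prime) (h2 : p ≠ 2) (h3 : p ≠ 3) {k : ℕ} (hk : k < p)
    (h : p ≤ 6 * k) : (p : ℤ) ∣ sexticCoeff k := by
  induction k with
  | zero => have := hp.pos; omega
  | succ k ih =>
    rw [← pow_one (p : ℤ)]
    apply hp.pow_dvd_of_dvd_pow_mul hk (i := 2)
    rw [sexticCoeff_succ, pow_one]
    rcases hp.mod_six h2 h3 with h6 | h6
    all_goals
      by_cases hk' : p ≤ 6 * k
      · exact Dvd.dvd.mul_left (ih (by omega) hk') _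
    · have : (p : ℤ) = 6 * k + 1 := by omega
      rw [this]
      exact ⟨12 * (6 * k + 5) * sexticCoeff k, by ring⟩
    · have : (p : ℤ) = 6 * k + 5 := by omega
      rw [this]
      exact ⟨12 * (6 * k + 1) * sexticCoeff k, by ring⟩

theorem sq_dvd_sexticCoeff (hp : p.Prime) (h2 : p ≠ 2) (h3 : p ≠ 3) {k : ℕ} (hk : k < p)
    (h : 5 * p ≤ 6 * k) : (p : ℤ) ^ 2 ∣ sexticCoeff k := by
  induction k with
  | zero => have := hp.pos; omega
  | succ k ih =>
    apply hp.pow_dvd_of_dvd_pow_mul hk (i := 2)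
    rw [sexticCoeff_succ]
    by_cases hk' : 5 * p ≤ 6 * k
    · exact Dvd.dvd.mul_left (ih (by omega) hk') _
    have hd := dvd_sexticCoeff hp h2 h3 (k := k) (by omega) (by have := hp.two_le; omega)
    rw [pow_two]
    refine mul_dvd_mul ?_ hd
    rcases hp.mod_six h2 h3 with h6 | h6
    · have : (6 * k + 5 : ℤ) = p * 5 := by omega
      rw [this]
      exact ⟨12 * (6 * k + 1) * 5, by ring⟩
    · have : (6 * k + 1 : ℤ) = p * 5 := by omega
      rw [this]
      exact ⟨12 * (6 * k + 5) * 5, by ring⟩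

/-- If neither index reaches `5p/6`, both exceed `p/6`, and each factor supplies one `p`. -/
theorem sq_dvd_sexticCoeff_mul (hp : p.Prime) (h2 : p ≠ 2) (h3 : p ≠ 3) {i j : ℕ} (hi : i < p)
    (hj : j < p) (h : p ≤ i + j) : (p : ℤ) ^ 2 ∣ sexticCoeff i * sexticCoeff j := by
  by_cases hi5 : 5 * p ≤ 6 * i
  · exact Dvd.dvd.mul_right (sq_dvd_sexticCoeff hp h2 h3 hi hi5) _
  by_cases hj5 : 5 * p ≤ 6 * j
  · exact Dvd.dvd.mul_left (sq_dvd_sexticCoeff hp h2 h3 hj hj5) _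
  rw [pow_two]
  exact mul_dvd_mul (dvd_sexticCoeff hp h2 h3 hi (by omega))
    (dvd_sexticCoeff hp h2 h3 hj (by omega))

theorem sq_dvd_sexticSqCoeff (hp : p.Prime) (h2 : p ≠ 2) (h3 : p ≠ 3) {k : ℕ} (hk : k < p)
    (h : p ≤ 2 * k) : (p : ℤ) ^ 2 ∣ sexticSqCoeff k := by
  rw [sexticSqCoeff_eq, pow_two]
  refine mul_dvd_mul ?_ (dvd_sexticCoeff hp h2 h3 hk (by omega))
  rw [Nat.centralBinom]
  exact_mod_cast hp.dvd_choose hk (by omega) h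

end Divisibility

/-! ### Clausen's formula for truncated series. -/

section Clausen

/-- The polynomial `X (1 - 432 X)`. -/
noncomputable def clausenArg : ℤ[X] := X - 432 * X ^ 2

/-- The symmetric square of the differential operator annihilating the sextic hypergeometric
series. -/
noncomputable def clausenOp (y : ℤ[X]) : ℤ[X] :=
  derivative (clausenArg * derivative (clausenArg * derivative y)) -
    240 * clausenArg * derivative y - 120 * derivative clausenArg * y

theorem derivative_clausenArg : derivative clausenArg = 1 - 864 * X := by
  simp only [clausenArg, derivative_sub, derivative_X, derivative_mul, derivative_ofNat, derivative_pow]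
  simp; ring

theorem derivative_X_pow_succ_mul (n : ℕ) (z : ℤ[X]) :
    derivative (X ^ (n + 1) * z) = X ^ n * (((n : ℤ[X]) + 1) * z + X * derivative z) := by
  simp [derivative_mul]; ring

/-- The operator sends `X ^ n` to `n³ X ^ (n - 1)` plus higher terms. Since `n³ ≠ 0` for `n > 0`, a
polynomial without constant term has its lower coefficients forced to vanish one by one. -/
theorem X_pow_dvd_of_clausenOp {M : ℕ} {y : ℤ[X]} (h0 : X ∣ y) (h : X ^ M ∣ clausenOp y) :
    X ^ (M + 1) ∣ y := by
  suffices ∀ n ≤ M, X ^ (n + 1) ∣ y from this M le_rfl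
  intro n hn
  induction n with
  | zero => simpa using h0
  | succ n ih =>
    obtain ⟨z, rfl⟩ := ih (by omega)
    obtain ⟨u, hu⟩ := (pow_dvd_pow X hn).trans h
    set w₁ := (1 - 432 * X) * (((n : ℤ[X]) + 1) * z + X * derivative z) with hw₁
    set w₂ := (1 - 432 * X) * (((n : ℤ[X]) + 1) * w₁ + X * derivative w₁) with hw₂
    have e₁ : clausenArg * derivative (X ^ (n + 1) * z) = X ^ (n + 1) * w₁ := by
      rw [derivative_X_pow_succ_mul, clausenArg, hw₁]; ring
    have e₂ : clausenArg * derivative (X ^ (n + 1) * w₁) = X ^ (n + 1) * w₂ := by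
      rw [derivative_X_pow_succ_mul, clausenArg, hw₂]; ring
    have hL : clausenOp (X ^ (n + 1) * z) = X ^ n * ((((n : ℤ[X]) + 1) * w₂ + X * derivative w₂) -
        240 * (X * w₁) - 120 * (1 - 864 * X) * (X * z)) := by
      rw [clausenOp, e₁, e₂, derivative_X_pow_succ_mul, derivative_clausenArg]
      linear_combination (-240 : ℤ[X]) * e₁
    rw [hL, pow_succ, mul_assoc (X ^ n)] at hu
    have hu' := mul_left_cancel₀ (pow_ne_zero n X_ne_zero) hu
    have hz : X ∣ z := by
      rw [X_dvd_iff, coeff_zero_eq_eval_zero]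
      have hev : ((n : ℤ) + 1) ^ 3 * eval 0 z = 0 := by
        have := congrArg (eval 0) hu'
        simp only [hw₂, hw₁, eval_sub, eval_mul, eval_add, eval_X, eval_one, eval_ofNat,
          eval_natCast] at this
        linear_combination this
      exact (mul_eq_zero.1 hev).resolve_left (by positivity)
    rw [pow_succ]
    exact mul_dvd_mul_left _ hz

/-- Truncated sextic hypergeometric series. -/
noncomputable def sexticPoly (N : ℕ) : ℤ[X] := ∑ k ∈ range N, C (sexticCoeff k) * X ^ k

/-- Truncation of the hypergeometric series with coefficients `sexticSqCoeff`, evaluated at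
`X (1 - 432 X)`. -/
noncomputable def sexticSqPoly (N : ℕ) : ℤ[X] :=
  ∑ k ∈ range N, C (sexticSqCoeff k) * clausenArg ^ k

theorem derivative_sexticPoly (N : ℕ) :
    derivative (clausenArg * derivative (sexticPoly N)) =
      60 * sexticPoly N - C ((N : ℤ) ^ 2 * sexticCoeff N) * X ^ (N - 1) := by
  induction N with
  | zero => simp [sexticPoly]
  | succ N ih =>
    have hs : sexticPoly (N + 1) = sexticPoly N + C (sexticCoeff N) * X ^ N := by
      rw [sexticPoly, sum_range_succ, sexticPoly]
    have key : derivative (clausenArg * derivative (X ^ N : ℤ[X])) =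
        (N : ℤ[X]) ^ 2 * X ^ (N - 1) - (432 * (N : ℤ[X]) * ((N : ℤ[X]) + 1)) * X ^ N := by
      rcases N with _ | n
      · simp
      · have : clausenArg * derivative (X ^ (n + 1) : ℤ[X]) =
          X ^ (n + 1) * (((n : ℤ[X]) + 1) * (1 - 432 * X)) := by
          rw [derivative_X_pow_succ, clausenArg]; simp; ring
        rw [this, derivative_X_pow_succ_mul]
        simp; ring
    have hC : C (((N + 1 : ℕ) : ℤ) ^ 2 * sexticCoeff (N + 1)) =
        (12 * (6 * (N : ℤ[X]) + 1) * (6 * N + 5)) * C (sexticCoeff N) := by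
      have := sexticCoeff_succ N
      push_cast
      rw [this]
      simp
    rw [hs, derivative_add, mul_add, derivative_add, ih, derivative_C_mul, mul_left_comm,
      derivative_C_mul, key, hC]
    simp
    ring

theorem X_pow_dvd_clausenOp_sexticPoly_sq (N : ℕ) :
    X ^ N ∣ clausenOp (sexticPoly (N + 1) ^ 2) := by
  set f := sexticPoly (N + 1)
  set e : ℤ[X] := C (((N + 1 : ℕ) : ℤ) ^ 2 * sexticCoeff (N + 1))
  have h : derivative (clausenArg * derivative f) = 60 * f - e * X ^ N := derivative_sexticPoly (N + 1)
  have h1 : clausenArg * derivative (f ^ 2) = 2 * (f * (clausenArg * derivative f)) := by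
    simp [derivative_pow]; ring
  -- The square of an exact solution would be annihilated; truncation only adds terms carrying the
  -- error `e * X ^ N`.
  have h2 : clausenArg * derivative (clausenArg * derivative (f ^ 2)) =
      2 * (clausenArg * derivative f) ^ 2 + 120 * (clausenArg * f ^ 2) -
        X ^ (N + 1) * (2 * (1 - 432 * X) * f * e) := by
    have hd : ∀ g, derivative (2 * (f * g)) = 2 * (derivative f * g + f * derivative g) := by
      intro g
      simp [derivative_mul]
    rw [h1, hd, h, clausenArg]
    ring
  have h3 : clausenOp (f ^ 2) = X ^ N * (-4 * (clausenArg * derivative f) * e -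
      (((N : ℤ[X]) + 1) * (2 * (1 - 432 * X) * f * e) +
        X * derivative (2 * (1 - 432 * X) * f * e))) := by
    rw [clausenOp, h2, derivative_sub, derivative_X_pow_succ_mul, derivative_add]
    have e1 : derivative (2 * (clausenArg * derivative f) ^ 2) =
        4 * (clausenArg * derivative f) * (60 * f - e * X ^ N) := by
      rw [derivative_mul, derivative_pow, h]; simp; ring
    have e2 : derivative (120 * (clausenArg * f ^ 2)) =
        120 * (derivative clausenArg * f ^ 2 + clausenArg * (2 * f * derivative f)) := by
      simp [derivative_mul, derivative_pow]
    rw [e1, e2, derivative_pow]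
    simp; ring
  rw [h3]
  exact dvd_mul_right _ _

theorem derivative_clausenArg_pow (k : ℕ) :
    clausenArg * derivative (clausenArg ^ k) = k * derivative clausenArg * clausenArg ^ k := by
  rcases k with _ | k
  · simp
  · rw [derivative_pow]; simp; ring

/-- Because `(u')² = 1 - 1728u` for `u = clausenArg`, the operator becomes, up to the factor `u'`,
the third-order hypergeometric operator in `u`. The recurrence then telescopes, leaving one top
term. -/
theorem clausenOp_sexticSqPoly (N : ℕ) :
    clausenOp (sexticSqPoly N) = -(derivative clausenArg * C ((N : ℤ) ^ 3 * sexticSqCoeff N) *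
      clausenArg ^ (N - 1)) := by
  induction N with
  | zero => simp [sexticSqPoly, clausenOp]
  | succ N ih =>
    have hs : sexticSqPoly (N + 1) = sexticSqPoly N + C (sexticSqCoeff N) * clausenArg ^ N := by
      rw [sexticSqPoly, sum_range_succ, sexticSqPoly]
    have hadd : ∀ y (c : ℤ) z, clausenOp (y + C c * z) = clausenOp y + C c * clausenOp z := by
      intro y c z
      simp only [clausenOp, derivative_add, derivative_C_mul, mul_add, mul_left_comm _ (C c)]
      ring
    have hsq : (derivative clausenArg) ^ 2 = 1 - 1728 * clausenArg := by
      rw [derivative_clausenArg, clausenArg]; ring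
    have hdd : derivative (derivative clausenArg) = -864 := by
      rw [derivative_clausenArg]; simp
    have key : clausenOp (clausenArg ^ N) = derivative clausenArg *
        ((N : ℤ[X]) ^ 3 * clausenArg ^ (N - 1) -
          24 * (2 * N + 1) * (6 * N + 1) * (6 * N + 5) * clausenArg ^ N) := by
      have a1 : clausenArg * derivative (clausenArg * derivative (clausenArg ^ N)) =
          (N : ℤ[X]) ^ 2 * clausenArg ^ N -
            (864 * (N : ℤ[X]) + 1728 * (N : ℤ[X]) ^ 2) * clausenArg ^ (N + 1) := by
        have a0 : derivative ((N : ℤ[X]) * derivative clausenArg * clausenArg ^ N) =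
            N * (-864 * clausenArg ^ N + derivative clausenArg * derivative (clausenArg ^ N)) := by
          rw [mul_assoc, derivative_mul, derivative_natCast, derivative_mul, hdd]; ring
        rw [derivative_clausenArg_pow, a0]
        linear_combination (N : ℤ[X]) * derivative clausenArg * derivative_clausenArg_pow N +
          (N : ℤ[X]) ^ 2 * clausenArg ^ N * hsq
      have a2 : derivative ((N : ℤ[X]) ^ 2 * clausenArg ^ N) =
          (N : ℤ[X]) ^ 3 * clausenArg ^ (N - 1) * derivative clausenArg := by
        rcases N with _ | n
        · simp
        · rw [derivative_mul, derivative_pow, derivative_pow]; simp; ring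
      have a3 : derivative ((864 * (N : ℤ[X]) + 1728 * (N : ℤ[X]) ^ 2) * clausenArg ^ (N + 1)) =
          (864 * (N : ℤ[X]) + 1728 * (N : ℤ[X]) ^ 2) * (((N : ℤ[X]) + 1) * clausenArg ^ N * derivative clausenArg) := by
        rw [derivative_mul, derivative_pow, derivative_add, derivative_mul, derivative_mul,
          derivative_pow]
        simp
      rw [clausenOp, a1, derivative_sub, a2, a3]
      linear_combination (-240 : ℤ[X]) * derivative_clausenArg_pow N
    have hC : C (((N + 1 : ℕ) : ℤ) ^ 3 * sexticSqCoeff (N + 1)) =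
        (24 * (2 * (N : ℤ[X]) + 1) * (6 * N + 1) * (6 * N + 5)) * C (sexticSqCoeff N) := by
      have := sexticSqCoeff_succ N
      push_cast
      rw [this]
      simp
    rw [hs, hadd, ih, key, hC]
    simp
    ring

theorem X_pow_dvd_sexticSqPoly_sub (N : ℕ) : X ^ N ∣ sexticSqPoly N - sexticPoly N ^ 2 := by
  rcases N with _ | N
  · simp
  have hX : (X : ℤ[X]) ∣ clausenArg := ⟨1 - 432 * X, by rw [clausenArg]; ring⟩
  apply X_pow_dvd_of_clausenOp
  · rw [X_dvd_iff]
    have h1 : (sexticSqPoly (N + 1)).coeff 0 = 1 := by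
      rw [coeff_zero_eq_eval_zero, sexticSqPoly, sum_range_succ']
      simp [eval_finsetSum, clausenArg, sexticSqCoeff]
    have h2 : (sexticPoly (N + 1)).coeff 0 = 1 := by
      rw [coeff_zero_eq_eval_zero, sexticPoly, sum_range_succ']
      simp [eval_finsetSum, sexticCoeff]
    rw [coeff_sub, pow_two, mul_coeff_zero, h1, h2]; norm_num
  · have hsub : ∀ y z, clausenOp (y - z) = clausenOp y - clausenOp z := by
      intro y z
      simp only [clausenOp, derivative_sub, mul_sub]
      ring
    rw [hsub]
    refine dvd_sub ?_ (X_pow_dvd_clausenOp_sexticPoly_sq N)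
    rw [clausenOp_sexticSqPoly, dvd_neg, Nat.add_sub_cancel]
    exact Dvd.dvd.mul_left (pow_dvd_pow_of_dvd hX N) _

theorem coeff_sexticPoly (N k : ℕ) :
    (sexticPoly N).coeff k = if k < N then sexticCoeff k else 0 := by
  simp [sexticPoly, coeff_X_pow]

/-- Below degree `p` the difference is zero over `ℤ`. A term reaching degree `p` or more needs `2k ≥
p` on one side and `i + j ≥ p` on the other, where `p²` divides the coefficients. -/
theorem C_sq_dvd_sexticSqPoly_sub {p : ℕ} (hp : p.Prime) (h2 : p ≠ 2) (h3 : p ≠ 3) :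
    C ((p : ℤ) ^ 2) ∣ sexticSqPoly p - sexticPoly p ^ 2 := by
  rw [C_dvd_iff_dvd_coeff]
  intro n
  by_cases hn : n < p
  · rw [X_pow_dvd_iff.1 (X_pow_dvd_sexticSqPoly_sub p) n hn]
    exact dvd_zero _
  rw [coeff_sub]
  refine dvd_sub ?_ ?_
  · rw [sexticSqPoly, finsetSum_coeff]
    refine dvd_sum fun k hk => ?_
    rw [coeff_C_mul]
    by_cases hkn : p ≤ 2 * k
    · exact Dvd.dvd.mul_right (sq_dvd_sexticSqCoeff hp h2 h3 (mem_range.1 hk) hkn) _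
    · rw [coeff_eq_zero_of_natDegree_lt, mul_zero]
      · exact dvd_zero _
      · have : clausenArg.natDegree ≤ 2 := by
          rw [clausenArg]; compute_degree
        calc _ ≤ k * clausenArg.natDegree := natDegree_pow_le
          _ ≤ k * 2 := by gcongr
          _ < n := by omega
  · rw [pow_two (sexticPoly p), coeff_mul]
    refine dvd_sum fun ij hij => ?_
    rw [Finset.HasAntidiagonal.mem_antidiagonal] at hij
    rw [coeff_sexticPoly, coeff_sexticPoly]
    split_ifs with hi hj
    · exact sq_dvd_sexticCoeff_mul hp h2 h3 hi hj (by omega)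
    all_goals simp

/-- A truncated form of Clausen's formula, valid modulo `p²`. -/
theorem sum_sexticSqCoeff_eq_sq {p : ℕ} (hp : p.Prime) (h2 : p ≠ 2) (h3 : p ≠ 3)
    {R : Type*} [CommRing R] (hR : (p : R) ^ 2 = 0) (y : R) :
    ∑ k ∈ range p, (sexticSqCoeff k : R) * (y * (1 - 432 * y)) ^ k =
      (∑ k ∈ range p, (sexticCoeff k : R) * y ^ k) ^ 2 := by
  obtain ⟨w, hw⟩ := C_sq_dvd_sexticSqPoly_sub hp h2 h3
  have := congrArg (eval₂ (Int.castRingHom R) y) hw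
  rw [eval₂_sub, eval₂_mul, eval₂_pow, eval₂_C] at this
  rw [eq_intCast, Int.cast_pow, Int.cast_natCast, hR, zero_mul] at this
  simp only [sexticSqPoly, sexticPoly, eval₂_finsetSum,
    eval₂_mul, eval₂_C, eval₂_pow, eval₂_X, clausenArg, eval₂_sub, eval₂_ofNat] at this
  simp only [eq_intCast] at this
  rw [sub_eq_zero] at this
  rw [← this]
  refine sum_congr rfl fun k _ => ?_
  ring

end Clausen

/-! ### The Hasse invariant as a hypergeometric sum and as a character sum. -/

section Coefficients

variable {p : ℕ} [Fact p.Prime]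

/-- Modulo `p` one has `m = -1/2`, and `(-1/2 choose j) (-4)^j` is the central binomial coefficient.
-/
theorem ZMod.choose_mul_neg_four_pow {m : ℕ} (hm : p = 2 * m + 1) {j : ℕ} (hj : j ≤ m) :
    (m.choose j : ZMod p) * (-4) ^ j = Nat.centralBinom j := by
  induction j with
  | zero => simp
  | succ j ih =>
    have h1 := Nat.choose_succ_right_eq m j
    have h2 := Nat.succ_mul_centralBinom_succ j
    apply_fun (Nat.cast : ℕ → ZMod p) at h1 h2
    push_cast [Nat.cast_sub (show j ≤ m by omega)] at h1 h2
    have h3 : (2 * m + 1 : ZMod p) = 0 := by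
      have h := congrArg (Nat.cast : ℕ → ZMod p) hm
      rw [CharP.cast_eq_zero] at h
      exact_mod_cast h.symm
    have hne : (j + 1 : ZMod p) ≠ 0 := by
      intro h
      have : ((j + 1 : ℕ) : ZMod p) = 0 := by exact_mod_cast h
      rw [ZMod.natCast_eq_zero_iff] at this
      exact absurd (Nat.le_of_dvd (by omega) this) (by omega)
    apply mul_left_cancel₀ hne
    rw [h2, ← ih (by omega), pow_succ]
    linear_combination (-4) * (-4) ^ j * h1 - 2 * (-4) ^ j * (m.choose j : ZMod p) * h3

theorem ZMod.sexticCoeff_eq (h2 : p ≠ 2) (h3 : p ≠ 3) {m : ℕ} (hm : p = 2 * m + 1) {k : ℕ}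
    (hk : k < p) :
    (sexticCoeff k : ZMod p) =
      (m.choose (3 * k) : ZMod p) * ((3 * k).choose k : ZMod p) * (-64) ^ k := by
  by_cases h : 3 * k ≤ m
  · have := ZMod.choose_mul_neg_four_pow hm h
    rw [pow_mul, show (-4 : ZMod p) ^ 3 = -64 by norm_num, Nat.centralBinom,
      show 2 * (3 * k) = 6 * k by ring] at this
    rw [sexticCoeff]
    push_cast
    rw [← this]
    ring
  · rw [Nat.choose_eq_zero_of_lt (by omega : m < 3 * k)]
    simpa using (ZMod.intCast_zmod_eq_zero_iff_dvd _ p).2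
      (dvd_sexticCoeff Fact.out h2 h3 hk (by omega))

theorem coeff_cubic_pow {K : Type*} [CommRing K] (m : ℕ) (s b : K) {N : ℕ} (hN : m < N) :
    ((X ^ 3 + C s * X ^ 2 + C b : K[X]) ^ m).coeff (2 * m) =
      ∑ i ∈ range N, (m.choose (3 * i) : K) * ((3 * i).choose i : K) * s ^ (m - 3 * i) * b ^ i := by
  have hexp : (X ^ 3 + C s * X ^ 2 + C b : K[X]) ^ m = ∑ j ∈ range (m + 1), ∑ i ∈ range N,
      C ((m.choose j : K) * (j.choose i : K) * s ^ (m - j) * b ^ i) *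
        X ^ (3 * (j - i) + 2 * (m - j)) := by
    rw [show (X ^ 3 + C s * X ^ 2 + C b : K[X]) = (C b + X ^ 3) + C s * X ^ 2 by ring, add_pow]
    refine sum_congr rfl fun j hj => ?_
    have hj' : j + 1 ≤ N := by rw [mem_range] at hj; omega
    rw [add_pow, sum_mul, sum_mul]
    rw [← sum_subset (range_mono hj')]
    · refine sum_congr rfl fun i _ => ?_
      simp only [C_mul, C_pow, map_natCast, mul_pow, pow_add, pow_mul]
      ring
    · intro i _ hi
      rw [Nat.choose_eq_zero_of_lt (show j < i by simpa using hi)]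
      simp
  rw [hexp, finsetSum_coeff]
  simp only [finsetSum_coeff, coeff_C_mul_X_pow]
  rw [sum_comm]
  refine sum_congr rfl fun i _ => ?_
  -- The exponent is `2m + j - 3i`, so only `j = 3i` reaches degree `2m`.
  rw [sum_eq_single (3 * i)]
  · by_cases h : 3 * i ≤ m
    · rw [if_pos (by omega)]
    · rw [Nat.choose_eq_zero_of_lt (by omega : m < 3 * i)]
      simp
  · intro j hj hji
    rw [mem_range] at hj
    by_cases hij : i ≤ j
    · rw [if_neg (by omega)]
    · rw [Nat.choose_eq_zero_of_lt (by omega : j < i)]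
      simp
  · intro h
    rw [Nat.choose_eq_zero_of_lt (by simpa using h)]
    simp

/-- The Hasse derivative of order `p - 1` is constant, as `p` divides `(n + p - 1 choose p - 1)` for
`0 < n < p`. This allows a translation by an element of the extension, which a sum over `ZMod p`
would not. -/
theorem coeff_taylor_of_natDegree_lt {K : Type*} [CommRing K] [Algebra (ZMod p) K] {f : K[X]}
    (hf : f.natDegree < 2 * p - 1) (r : K) : (taylor r f).coeff (p - 1) = f.coeff (p - 1) := by
  have hp : p.Prime := Fact.out
  have hh : hasseDeriv (p - 1) f = C (f.coeff (p - 1)) := by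
    ext n
    rw [hasseDeriv_coeff, coeff_C]
    split_ifs with hn
    · simp [hn]
    by_cases hnp : n < p
    · have : p ∣ (n + (p - 1)).choose (p - 1) :=
        hp.dvd_choose (by have := hp.pos; omega) (by omega) (by omega)
      have h0 : (((n + (p - 1)).choose (p - 1) : ℕ) : ZMod p) = 0 :=
        (ZMod.natCast_eq_zero_iff _ _).2 this
      rw [← map_natCast (algebraMap (ZMod p) K), h0, map_zero, zero_mul]
    · rw [coeff_eq_zero_of_natDegree_lt (by omega), mul_zero]
  rw [taylor_coeff, hh, eval_C]

/-- The Hasse invariant of `y² = x³ - 11x + 14` as a truncated hypergeometric sum. -/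
theorem coeff_pow_eq_mul_sum {K : Type*} [CommRing K] [Algebra (ZMod p) K] (h2 : p ≠ 2)
    (h3 : p ≠ 3) {m : ℕ} (hm : p = 2 * m + 1) {l y : K} (hl : 3 * l ^ 2 = 11)
    (hy : 14 - 2 * l ^ 3 = -64 * (3 * l) ^ 3 * y) :
    ((X ^ 3 - 11 * X + 14 : K[X]) ^ m).coeff (2 * m) =
      (3 * l) ^ m * ∑ k ∈ range p, (sexticCoeff k : K) * y ^ k := by
  have hdeg : ((X ^ 3 - 11 * X + 14 : K[X]) ^ m).natDegree < 2 * p - 1 := by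
    have : (X ^ 3 - 11 * X + 14 : K[X]).natDegree ≤ 3 := by compute_degree
    calc _ ≤ m * (X ^ 3 - 11 * X + 14 : K[X]).natDegree := natDegree_pow_le
      _ ≤ m * 3 := by gcongr
      _ < _ := by omega
  have h := coeff_taylor_of_natDegree_lt hdeg l
  rw [show p - 1 = 2 * m by omega] at h
  rw [← h, taylor_apply]
  -- The condition `3l² = 11` makes the linear term vanish after the shift by `l`.
  have hcomp : ((X ^ 3 - 11 * X + 14 : K[X]) ^ m).comp (X + C l) =
      (X ^ 3 + C (3 * l) * X ^ 2 + C (14 - 2 * l ^ 3)) ^ m := by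
    rw [pow_comp]
    congr 1
    have hl' : (3 * C l ^ 2 : K[X]) = 11 := by
      have := congrArg (C : K → K[X]) hl
      simpa only [C_mul, C_pow, map_ofNat] using this
    simp only [add_comp, sub_comp, mul_comp, X_pow_comp, X_comp, ofNat_comp, C_mul, C_sub, C_pow,
      map_ofNat]
    linear_combination (X + C l) * hl'
  rw [hcomp, coeff_cubic_pow m _ _ (show m < p by omega), mul_sum]
  refine sum_congr rfl fun k hk => ?_
  have hc := congrArg (algebraMap (ZMod p) K) (ZMod.sexticCoeff_eq h2 h3 hm (mem_range.1 hk))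
  simp only [map_intCast, map_mul, map_natCast, map_pow, map_neg, map_ofNat] at hc
  rw [hc, hy]
  by_cases hkm : 3 * k ≤ m
  · have : (3 * l) ^ m = (3 * l) ^ (m - 3 * k) * ((3 * l) ^ 3) ^ k := by
      rw [← pow_mul, ← pow_add]; congr 1; omega
    rw [this]
    generalize (3 * l) ^ 3 = w
    rw [mul_pow, mul_pow]
    ring
  · rw [Nat.choose_eq_zero_of_lt (by omega : m < 3 * k)]
    simp

theorem ZMod.sum_pow_eq_ite {i : ℕ} (hi : i < 2 * (p - 1)) :
    ∑ u : ZMod p, u ^ i = if i = p - 1 then -1 else 0 := by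
  have hp : p.Prime := Fact.out
  have hp2 := hp.two_le
  rcases lt_trichotomy i (p - 1) with h | h | h
  · rw [if_neg h.ne]
    exact FiniteField.sum_pow_lt_card_sub_one _ _ (by rwa [ZMod.card])
  · rw [if_pos h, h]
    have : ∀ u : ZMod p, u ^ (p - 1) = 1 - if u = 0 then 1 else 0 := by
      intro u
      split_ifs with hu
      · rw [hu, zero_pow (by omega)]; ring
      · rw [ZMod.pow_card_sub_one_eq_one hu]; ring
    simp [this, sum_sub_distrib]
  · rw [if_neg h.ne']
    have : ∀ u : ZMod p, u ^ i = u ^ (i - (p - 1)) := by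
      intro u
      calc u ^ i = u ^ p * u ^ (i - p) := by rw [← pow_add]; congr 1; omega
        _ = u * u ^ (i - p) := by rw [ZMod.pow_card]
        _ = u ^ (i - (p - 1)) := by rw [← pow_succ']; congr 1; omega
    simp only [this]
    exact FiniteField.sum_pow_lt_card_sub_one _ _ (by rw [ZMod.card]; omega)

theorem ZMod.sum_eval_eq_neg_coeff {f : (ZMod p)[X]} (hf : f.natDegree < 2 * (p - 1)) :
    ∑ u : ZMod p, f.eval u = -f.coeff (p - 1) := by
  have hp2 := (Fact.out : p.Prime).two_le
  simp only [eval_eq_sum_range' hf]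
  rw [sum_comm]
  simp only [← mul_sum]
  rw [sum_congr rfl fun i hi => by rw [ZMod.sum_pow_eq_ite (mem_range.1 hi)]]
  simp
  omega

/-- Euler's criterion turns `f ^ m` into the quadratic character. Its degree is at most `3m < 2(p -
1)`, so only the coefficient of `X ^ (p - 1)` survives summation. -/
theorem ZMod.coeff_pow_eq_neg_sum_quadraticChar {m : ℕ} (hm : p = 2 * m + 1) (hm0 : m ≠ 0)
    {f : (ZMod p)[X]} (hf : f.natDegree ≤ 3) :
    (f ^ m).coeff (2 * m) = -((∑ u : ZMod p, quadraticChar (ZMod p) (f.eval u) : ℤ) : ZMod p) := by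
  have hdeg : (f ^ m).natDegree < 2 * (p - 1) := by
    calc _ ≤ m * f.natDegree := natDegree_pow_le
      _ ≤ m * 3 := by gcongr
      _ < _ := by omega
  have h := ZMod.sum_eval_eq_neg_coeff hdeg
  rw [show p - 1 = 2 * m by omega] at h
  rw [← neg_eq_iff_eq_neg.2 h]
  push_cast
  congr 1
  refine sum_congr rfl fun u _ => ?_
  rw [quadraticChar_eq_pow_of_char_ne_two' (by rw [ZMod.ringChar_zmod_n]; omega), eval_pow,
    ZMod.card]
  congr 1
  omega

end Coefficients

/-! ### Quadratic character sums and Jacobsthal's theorem. -/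

section CharacterSums

variable {F : Type*} [Field F] [Fintype F] [DecidableEq F]

theorem card_filter_sq_eq (hF : ringChar F ≠ 2) (a : F) :
    ((univ.filter fun x : F => x ^ 2 = a).card : ℤ) = quadraticChar F a + 1 := by
  rw [← quadraticChar_card_sqrts hF a]
  congr 2
  ext x
  simp

theorem card_filter_add_inv_eq (hF : ringChar F ≠ 2) (t : F) :
    ((univ.filter fun x : F => x ≠ 0 ∧ x + x⁻¹ = t).card : ℤ) = quadraticChar F (t ^ 2 - 4) + 1 := by
  have h2 : (2 : F) ≠ 0 := Ring.two_ne_zero hF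
  rw [← card_filter_sq_eq hF]
  congr 1
  refine card_bij' (fun x _ => 2 * x - t) (fun z _ => (z + t) / 2) ?_ ?_ ?_ ?_
  · intro x hx
    simp only [mem_filter, mem_univ, true_and] at hx ⊢
    obtain ⟨hx, rfl⟩ := hx
    field_simp
    ring
  · intro z hz
    simp only [mem_filter, mem_univ, true_and] at hz ⊢
    have hzt : (z + t) * (t - z) = 4 := by linear_combination -hz
    have h4 : (4 : F) ≠ 0 := by
      rw [show (4 : F) = 2 * 2 by norm_num]; exact mul_ne_zero h2 h2
    have hne : z + t ≠ 0 := by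
      intro h
      rw [h, zero_mul] at hzt
      exact h4 hzt.symm
    refine ⟨div_ne_zero hne h2, ?_⟩
    field_simp
    linear_combination hz
  · intro x _
    field_simp
    ring
  · intro z _
    field_simp
    ring

/-- The two-isogeny relating `y² = x³ + ax² + x` and `y² = (t + a)(t² - 4)`, on the level of
character sums. -/
theorem sum_quadraticChar_two_isogeny (hF : ringChar F ≠ 2) (a : F) :
    ∑ x : F, quadraticChar F (x ^ 3 + a * x ^ 2 + x) =
      ∑ t : F, quadraticChar F ((t + a) * (t ^ 2 - 4)) := by
  have h1 : ∑ x : F, quadraticChar F (x ^ 3 + a * x ^ 2 + x) =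
      ∑ x ∈ univ.filter (fun x : F => x ≠ 0), quadraticChar F (x + x⁻¹ + a) := by
    rw [sum_filter]
    refine sum_congr rfl fun x _ => ?_
    split_ifs with hx
    · have : x ^ 3 + a * x ^ 2 + x = x ^ 2 * (x + x⁻¹ + a) := by field_simp; ring
      rw [this, map_mul, quadraticChar_sq_one' hx, one_mul]
    · rw [not_not] at hx
      simp [hx]
  -- Group by `t = x + x⁻¹`: the fibre has `χ(t² - 4) + 1` elements.
  have h2 : ∑ x ∈ univ.filter (fun x : F => x ≠ 0), quadraticChar F (x + x⁻¹ + a) =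
      ∑ t : F, quadraticChar F (t + a) * (quadraticChar F (t ^ 2 - 4) + 1) := by
    rw [← sum_fiberwise _ (fun x : F => x + x⁻¹)]
    refine sum_congr rfl fun t _ => ?_
    rw [filter_filter, sum_congr rfl (g := fun _ => quadraticChar F (t + a)), sum_const,
      nsmul_eq_mul, ← card_filter_add_inv_eq hF t, mul_comm]
    intro x hx
    rw [(mem_filter.1 hx).2.2]
  have h3 : ∑ t : F, quadraticChar F (t + a) = 0 := by
    rw [← quadraticChar_sum_zero hF]
    exact Equiv.sum_comp (Equiv.addRight a) (fun t => quadraticChar F t)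
  rw [h1, h2]
  simp only [mul_add, mul_one, sum_add_distrib, h3, add_zero, map_mul]

/-- The Jacobsthal sum `∑ χ(x³ - kx)`. -/
def jacobsthalSum (k : F) : ℤ := ∑ x : F, quadraticChar F (x ^ 3 - k * x)

/-- Moving the root 2 to the origin gives `x³ + 6x² + x`. The isogenous cubic has equally spaced
roots `-6, -2, 2`, which `t = 4v - 2` carries to `-1, 0, 1`. -/
theorem sum_quadraticChar_eq_jacobsthalSum (hF : ringChar F ≠ 2) :
    ∑ u : F, quadraticChar F (u ^ 3 - 11 * u + 14) = jacobsthalSum (1 : F) := by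
  have h2 : (2 : F) ≠ 0 := Ring.two_ne_zero hF
  have h4 : (4 : F) ≠ 0 := by
    rw [show (4 : F) = 2 * 2 by norm_num]; exact mul_ne_zero h2 h2
  rw [← Equiv.sum_comp (Equiv.addRight (2 : F))]
  have e1 : ∀ x : F, (Equiv.addRight (2 : F) x) ^ 3 - 11 * (Equiv.addRight (2 : F) x) + 14 =
      x ^ 3 + 6 * x ^ 2 + x := by
    intro x
    simp only [Equiv.coe_addRight]
    ring
  simp only [e1]
  rw [sum_quadraticChar_two_isogeny hF, jacobsthalSum,
    ← Equiv.sum_comp ((Equiv.mulLeft₀ (4 : F) h4).trans (Equiv.addRight (-2 : F)))]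
  refine sum_congr rfl fun v _ => ?_
  simp only [Equiv.trans_apply, Equiv.mulLeft₀_apply, Equiv.coe_addRight]
  rw [show (4 * v + -2 + 6) * ((4 * v + -2) ^ 2 - 4) = (2 ^ 3) ^ 2 * (v ^ 3 - 1 * v) by ring,
    map_mul, quadraticChar_sq_one' (pow_ne_zero 3 h2), one_mul]

theorem jacobsthalSum_eq_zero (h : quadraticChar F (-1) = -1) (k : F) :
    jacobsthalSum k = 0 := by
  have : jacobsthalSum k = -jacobsthalSum k := by
    unfold jacobsthalSum
    conv_lhs => rw [← Equiv.sum_comp (Equiv.neg F)]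
    rw [← sum_neg_distrib]
    refine sum_congr rfl fun x _ => ?_
    rw [Equiv.neg_apply, show (-x) ^ 3 - k * -x = -1 * (x ^ 3 - k * x) by ring, map_mul, h,
      neg_one_mul]
  omega

theorem sum_quadraticChar_mul_sub (hF : ringChar F ≠ 2) (a b : F) :
    ∑ k : F, quadraticChar F ((a - k) * (b - k)) =
      (if a = b then (Fintype.card F : ℤ) else 0) - 1 := by
  rw [← Equiv.sum_comp (Equiv.subLeft a)]
  simp only [Equiv.subLeft_apply, sub_sub_cancel]
  have e : ∀ k : F, quadraticChar F (k * (b - (a - k))) =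
      if k = 0 then 0 else quadraticChar F (1 + (b - a) * k⁻¹) := by
    intro k
    split_ifs with hk
    · simp [hk]
    · rw [show k * (b - (a - k)) = k ^ 2 * (1 + (b - a) * k⁻¹) by field_simp; ring, map_mul,
        quadraticChar_sq_one' hk, one_mul]
  simp only [e]
  -- Since `0⁻¹ = 0`, the completed sum has the extra term `χ(1) = 1` at `k = 0`.
  have e2 : ∀ k : F, (if k = 0 then 0 else quadraticChar F (1 + (b - a) * k⁻¹)) =
      quadraticChar F (1 + (b - a) * k⁻¹) - if k = 0 then 1 else 0 := by
    intro k
    split_ifs with hk <;> simp [hk]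
  simp only [e2, sum_sub_distrib, sum_ite_eq', mem_univ, if_true]
  congr 1
  split_ifs with hab
  · simp [hab]
  · rw [← quadraticChar_sum_zero hF]
    have hba : b - a ≠ 0 := sub_ne_zero.2 (Ne.symm hab)
    exact Equiv.sum_comp (((Equiv.inv F).trans (Equiv.mulLeft₀ _ hba)).trans (Equiv.addLeft 1))
      (fun t => quadraticChar F t)

theorem sum_jacobsthalSum_sq (hF : ringChar F ≠ 2) (h : quadraticChar F (-1) = 1) :
    ∑ k : F, jacobsthalSum k ^ 2 = 2 * Fintype.card F * (Fintype.card F - 1 : ℤ) := by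
  have hsq : ∀ k : F, jacobsthalSum k ^ 2 = ∑ x : F, ∑ y : F,
      quadraticChar F x * quadraticChar F y * quadraticChar F ((x ^ 2 - k) * (y ^ 2 - k)) := by
    intro k
    rw [pow_two, jacobsthalSum, sum_mul_sum]
    refine sum_congr rfl fun x _ => sum_congr rfl fun y _ => ?_
    simp only [← map_mul]
    congr 1
    ring
  simp only [hsq]
  rw [sum_comm]
  have hx : ∀ x : F, ∑ k : F, ∑ y : F,
      quadraticChar F x * quadraticChar F y * quadraticChar F ((x ^ 2 - k) * (y ^ 2 - k)) =
      (Fintype.card F : ℤ) * (2 - if x = 0 then 2 else 0) := by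
    intro x
    rw [sum_comm]
    simp only [← mul_sum, sum_quadraticChar_mul_sub hF]
    have : ∀ y : F, quadraticChar F x * quadraticChar F y *
        ((if x ^ 2 = y ^ 2 then (Fintype.card F : ℤ) else 0) - 1) =
        (if x ^ 2 = y ^ 2 then (Fintype.card F : ℤ) * (quadraticChar F x * quadraticChar F y) else 0)
          - quadraticChar F x * quadraticChar F y := by
      intro y
      split_ifs <;> ring
    simp only [this, sum_sub_distrib, ← mul_sum, quadraticChar_sum_zero hF, mul_zero, sub_zero]
    rw [← sum_filter, ← mul_sum]
    congr 1
    split_ifs with hx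
    · simp [hx]
    · have h2 : (2 : F) ≠ 0 := Ring.two_ne_zero hF
      have hne : x ≠ -x := by
        intro h'
        have : 2 * x = 0 := by linear_combination h'
        exact (mul_ne_zero h2 hx) this
      have hset : univ.filter (fun y : F => x ^ 2 = y ^ 2) = {x, -x} := by
        ext y
        simp only [mem_filter, mem_univ, true_and, mem_insert, mem_singleton]
        rw [eq_comm, sq_eq_sq_iff_eq_or_eq_neg]
      rw [hset, sum_pair hne, ← neg_one_mul x, map_mul, h]
      have := quadraticChar_sq_one hx
      linear_combination 2 * this
  simp only [hx, ← mul_sum, sum_sub_distrib, sum_const, card_univ, nsmul_eq_mul, sum_ite_eq', mem_univ,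
    if_true]
  ring

theorem jacobsthalSum_mul_sq (k : F) {c : F} (hc : c ≠ 0) :
    jacobsthalSum (k * c ^ 2) = quadraticChar F c * jacobsthalSum k := by
  unfold jacobsthalSum
  rw [← Equiv.sum_comp (Equiv.mulLeft₀ c hc), mul_sum]
  refine sum_congr rfl fun x _ => ?_
  rw [Equiv.mulLeft₀_apply, show (c * x) ^ 3 - k * c ^ 2 * (c * x) = c ^ 2 * (c * (x ^ 3 - k * x)) by
    ring, map_mul, quadraticChar_sq_one' hc, one_mul, map_mul]

theorem jacobsthalSum_mul_sq_sq (k : F) {c : F} (hc : c ≠ 0) :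
    jacobsthalSum (k * c ^ 2) ^ 2 = jacobsthalSum k ^ 2 := by
  rw [jacobsthalSum_mul_sq k hc, mul_pow, quadraticChar_sq_one hc, one_mul]

theorem jacobsthalSum_zero (hF : ringChar F ≠ 2) : jacobsthalSum (0 : F) = 0 := by
  rw [← quadraticChar_sum_zero hF, jacobsthalSum]
  refine sum_congr rfl fun x _ => ?_
  by_cases hx : x = 0
  · simp [hx]
  · rw [show x ^ 3 - 0 * x = x ^ 2 * x by ring, map_mul, quadraticChar_sq_one' hx, one_mul]

/-- Jacobsthal's theorem: `4q` is the sum of the squares of two Jacobsthal sums. -/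
theorem jacobsthalSum_sq_add_sq (hF : ringChar F ≠ 2) (h : quadraticChar F (-1) = 1) {n : F}
    (hn : quadraticChar F n = -1) :
    jacobsthalSum (1 : F) ^ 2 + jacobsthalSum n ^ 2 = 4 * Fintype.card F := by
  have hn0 : n ≠ 0 := by
    rintro rfl
    simp at hn
  -- For `k ≠ 0` the square depends only on `χ(k)`, so it is affine in `χ(k)`; summing over `k`
  -- kills the character part.
  have hk : ∀ k : F, 2 * jacobsthalSum k ^ 2 =
      (jacobsthalSum (1 : F) ^ 2 + jacobsthalSum n ^ 2) * (1 - if k = 0 then 1 else 0) +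
        (jacobsthalSum (1 : F) ^ 2 - jacobsthalSum n ^ 2) * quadraticChar F k := by
    intro k
    by_cases hk : k = 0
    · simp [hk, jacobsthalSum_zero hF]
    rw [if_neg hk]
    rcases quadraticChar_dichotomy hk with h1 | h1
    · obtain ⟨c, rfl⟩ := (quadraticChar_one_iff_isSquare hk).1 h1
      have hc : c ≠ 0 := by
        rintro rfl
        simp at hk
      have := jacobsthalSum_mul_sq_sq 1 hc
      rw [one_mul, pow_two c] at this
      rw [h1, this]
      ring
    · have hkn : quadraticChar F (k * n) = 1 := by rw [map_mul, h1, hn]; norm_num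
      obtain ⟨c, hc⟩ := (quadraticChar_one_iff_isSquare (mul_ne_zero hk hn0)).1 hkn
      have hc0 : c ≠ 0 := by
        rintro rfl
        simp [hk, hn0] at hc
      have hkc : k = n * (c / n) ^ 2 := by
        field_simp
        linear_combination hc
      have := jacobsthalSum_mul_sq_sq n (div_ne_zero hc0 hn0)
      rw [← hkc] at this
      rw [h1, this]
      ring
  have hs := sum_jacobsthalSum_sq hF h
  have hs2 : ∑ k : F, 2 * jacobsthalSum k ^ 2 =
      (jacobsthalSum (1 : F) ^ 2 + jacobsthalSum n ^ 2) * (Fintype.card F - 1 : ℤ) := by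
    simp only [hk, sum_add_distrib, ← mul_sum, quadraticChar_sum_zero hF, mul_zero, add_zero,
      sum_sub_distrib, sum_ite_eq', mem_univ, if_true, sum_const, card_univ, nsmul_eq_mul, mul_one]
  rw [← mul_sum, hs] at hs2
  have hcard : (Fintype.card F - 1 : ℤ) ≠ 0 := by
    have := Fintype.one_lt_card (α := F)
    omega
  apply mul_right_cancel₀ hcard
  linear_combination -hs2

theorem jacobsthalSum_one_eq (hF : ringChar F ≠ 2) (h : quadraticChar F (-1) = 1) :
    ∃ t : ℤ, jacobsthalSum (1 : F) = 4 * t + 3 - Fintype.card F := by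
  have h2 : (2 : F) ≠ 0 := Ring.two_ne_zero hF
  set A := univ.filter fun x : F => quadraticChar F (x ^ 3 - 1 * x) = 1 with hA
  set B := univ.filter fun x : F => x ^ 3 - 1 * x = 0 with hB
  have hBc : B.card = 3 := by
    have h1 : (1 : F) ≠ -1 := by
      intro h'
      exact h2 (by linear_combination h')
    have : B = {0, 1, -1} := by
      ext x
      simp only [hB, mem_filter, mem_univ, true_and, mem_insert, mem_singleton]
      constructor
      · intro hx
        have : x * ((x - 1) * (x + 1)) = 0 := by linear_combination hx
        rcases mul_eq_zero.1 this with h | h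
        · exact Or.inl h
        rcases mul_eq_zero.1 h with h | h
        · exact Or.inr (Or.inl (sub_eq_zero.1 h))
        · exact Or.inr (Or.inr (eq_neg_of_add_eq_zero_left h))
      · rintro (rfl | rfl | rfl) <;> ring
    rw [this, card_eq_three]
    exact ⟨0, 1, -1, by simp, by simp, h1, rfl⟩
  have hterm : ∀ x : F, quadraticChar F (x ^ 3 - 1 * x) =
      2 * (if quadraticChar F (x ^ 3 - 1 * x) = 1 then 1 else 0) +
        (if x ^ 3 - 1 * x = 0 then 1 else 0) - 1 := by
    intro x
    by_cases hx : x ^ 3 - 1 * x = 0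
    · rw [hx]; simp
    · rcases quadraticChar_dichotomy hx with h1 | h1 <;> rw [h1, if_neg hx] <;> norm_num
  have hsum : jacobsthalSum (1 : F) = 2 * A.card + 3 - Fintype.card F := by
    rw [jacobsthalSum, sum_congr rfl fun x _ => hterm x]
    simp only [sum_sub_distrib, sum_add_distrib, ← mul_sum, sum_boole, sum_const, card_univ,
      nsmul_eq_mul, mul_one]
    rw [← hA, ← hB, hBc]
    norm_num
  -- As `χ(-1) = 1`, negation preserves `A`, and it has no fixed point there.
  have heven : ((A.card : ℕ) : ZMod 2) = 0 := by
    rw [card_eq_sum_ones, Nat.cast_sum]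
    refine sum_involution (fun x _ => -x) (fun _ _ => by decide) ?_ ?_ ?_
    · intro x hx _ hxx
      have hx0 : x = 0 := by
        have : 2 * x = 0 := by linear_combination -hxx
        exact (mul_eq_zero.1 this).resolve_left h2
      rw [hA, mem_filter, hx0] at hx
      simp at hx
    · intro x hx
      rw [hA, mem_filter] at hx ⊢
      refine ⟨mem_univ _, ?_⟩
      rw [show (-x) ^ 3 - 1 * -x = -1 * (x ^ 3 - 1 * x) by ring, map_mul, h, hx.2, one_mul]
    · intro x _
      exact neg_neg x
  rw [ZMod.natCast_eq_zero_iff] at heven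
  obtain ⟨t, ht⟩ := heven
  exact ⟨t, by rw [hsum, ht]; push_cast; ring⟩

end CharacterSums

/-! ### Uniqueness of the two-square representation, and the value of the Jacobsthal sum. -/

theorem sq_eq_sq_of_sum_two_squares_eq_prime {p : ℕ} (hp : p.Prime) {a b c d : ℤ}
    (hab : (p : ℤ) = a ^ 2 + b ^ 2) (hcd : (p : ℤ) = c ^ 2 + d ^ 2) (hp2 : p ≠ 2) (ha : ¬ 2 ∣ a)
    (hc : ¬ 2 ∣ c) : a ^ 2 = c ^ 2 := by
  have hp0 : (p : ℤ) ≠ 0 := by exact_mod_cast hp.ne_zero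
  have hb : Even b := by
    have hodd : Odd (p : ℤ) := by exact_mod_cast hp.odd_of_ne_two hp2
    have ha' : Odd a := by rwa [← Int.not_even_iff_odd, even_iff_two_dvd]
    rw [hab, Int.odd_add] at hodd
    have := hodd.1 ha'.pow
    exact (Int.even_pow.1 this).1
  -- In `p² = (ac + bd)² + (ad - bc)²` the second square is `0` or `p²`. The latter gives `c = ±b`,
  -- impossible since `b` is even and `c` odd.
  have key : ∀ d : ℤ, (p : ℤ) = c ^ 2 + d ^ 2 → (p : ℤ) ∣ a * d - b * c → a ^ 2 = c ^ 2 := by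
    rintro d hcd ⟨t, ht⟩
    have hid : (a * c + b * d) ^ 2 + (p * t) ^ 2 = (p : ℤ) ^ 2 := by
      rw [← ht]
      linear_combination (-(p : ℤ)) * hab - (a ^ 2 + b ^ 2) * hcd
    have hcp : c * p = a * (a * c + b * d) - b * (p * t) := by
      rw [← ht, hab]; ring
    have ht1 : t ^ 2 ≤ 1 := by
      have : (0 : ℤ) < (p : ℤ) ^ 2 := by positivity
      nlinarith [sq_nonneg (a * c + b * d)]
    have htc : t = 0 ∨ t ^ 2 = 1 := by
      rcases eq_or_ne t 0 with h | h
      · exact Or.inl h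
      · exact Or.inr (le_antisymm ht1 (by have := sq_pos_of_ne_zero h; omega))
    rcases htc with rfl | ht2
    · have h1 : (a * c + b * d) ^ 2 = (p : ℤ) ^ 2 := by linear_combination hid
      have h2 : (c ^ 2 - a ^ 2) * (p : ℤ) ^ 2 = 0 := by
        linear_combination (c * p + a * (a * c + b * d)) * hcp + a ^ 2 * h1
      rcases mul_eq_zero.1 h2 with h | h
      · omega
      · exact absurd h (pow_ne_zero 2 hp0)
    · have h1 : (a * c + b * d) ^ 2 = 0 := by linear_combination hid - (p : ℤ) ^ 2 * ht2
      have h2 : a * c + b * d = 0 := by simpa using h1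
      rw [h2] at hcp
      have h3 : c = -(b * t) := by
        apply mul_right_cancel₀ hp0
        linear_combination hcp
      exact absurd (h3 ▸ (Dvd.dvd.mul_right hb.two_dvd t).neg_right) hc
  have hdvd : (p : ℤ) ∣ (a * d - b * c) * (a * d - b * -c) :=
    ⟨a ^ 2 - c ^ 2, by linear_combination (-a ^ 2) * hcd + c ^ 2 * hab⟩
  rcases (Nat.prime_iff_prime_int.1 hp).dvd_or_dvd hdvd with h | h
  · exact key d hcd h
  · refine key (-d) (by rw [neg_sq]; exact hcd) ?_
    have := h.neg_right
    rwa [show -(a * d - b * -c) = a * -d - b * c by ring] at this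

/-- Here `4t + 3 - p` is 2 modulo 4, so half the sum is the odd member of a two-square
representation of `p`. -/
theorem jacobsthalSum_sq_eq {p : ℕ} [Fact p.Prime] (hp : p % 4 = 1) {a b : ℤ}
    (hab : (p : ℤ) = a ^ 2 + b ^ 2) (ha : ¬ 2 ∣ a) :
    jacobsthalSum (1 : ZMod p) ^ 2 = 4 * a ^ 2 := by
  have hp2 : p ≠ 2 := by omega
  have hF : ringChar (ZMod p) ≠ 2 := by rwa [ZMod.ringChar_zmod_n]
  have h1 : quadraticChar (ZMod p) (-1) = 1 := by
    rw [quadraticChar_neg_one hF, ZMod.card, ZMod.χ₄_nat_one_mod_four hp]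
  obtain ⟨n, hn⟩ := quadraticChar_exists_neg_one hF
  have hs := jacobsthalSum_sq_add_sq hF h1 hn
  obtain ⟨t, ht⟩ := jacobsthalSum_one_eq hF h1
  rw [ZMod.card] at hs ht
  obtain ⟨r, hr⟩ : ∃ r : ℤ, (p : ℤ) = 4 * r + 1 := ⟨p / 4, by omega⟩
  have hc : jacobsthalSum (1 : ZMod p) = 2 * (2 * t + 1 - 2 * r) := by rw [ht, hr]; ring
  obtain ⟨d, hd⟩ : (2 : ℤ) ∣ jacobsthalSum n := by
    apply Int.prime_two.dvd_of_dvd_pow (n := 2)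
    refine ⟨2 * p - 2 * (2 * t + 1 - 2 * r) ^ 2, ?_⟩
    rw [hc] at hs
    linear_combination hs
  rw [hc, hd] at hs
  have := sq_eq_sq_of_sum_two_squares_eq_prime Fact.out hab
    (show (p : ℤ) = (2 * t + 1 - 2 * r) ^ 2 + d ^ 2 by linarith) hp2 ha (by omega)
  rw [hc, this]
  ring

/-! ### Adjoining `√33` and solving for the argument. -/

section QuadraticExtension

/-- The extension of a ring by a formal square root of `33`. -/
abbrev AdjoinSqrt (A : Type*) [CommRing A] : Type _ := QuadraticAlgebra A (33 : A) 0

namespace AdjoinSqrt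

variable {A B : Type*} [CommRing A] [CommRing B]

/-- The adjoined square root of `33`. -/
def root (A : Type*) [CommRing A] : AdjoinSqrt A := ⟨0, 1⟩

theorem root_sq : root A ^ 2 = 33 := by
  calc root A ^ 2 = ((33 : ℕ) : AdjoinSqrt A) := by
        rw [pow_two]
        ext
        · rw [QuadraticAlgebra.re_natCast]
          simp [root]
        · rw [QuadraticAlgebra.im_natCast]
          simp [root]
    _ = 33 := Nat.cast_ofNat

/-- The ring homomorphism between the extensions by `√33` induced by a ring homomorphism. -/
def map (f : A →+* B) : AdjoinSqrt A →+* AdjoinSqrt B where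
  toFun z := ⟨f z.re, f z.im⟩
  map_one' := by ext <;> simp [QuadraticAlgebra.re_one, QuadraticAlgebra.im_one]
  map_zero' := by ext <;> simp
  map_add' _ _ := by ext <;> simp
  map_mul' _ _ := by ext <;> simp [map_ofNat f 33]

theorem natCast_mul_mk (n : ℕ) (u v : A) :
    (n : AdjoinSqrt A) * ⟨u, v⟩ = ⟨n * u, n * v⟩ := by
  ext <;> simp

end AdjoinSqrt

/-- The argument `(1 - 21√33/121)/864`, where `i` stands for `1/66` and `ω` for `√33`. -/
def sexticArg {R : Type*} [CommRing R] (i ω : R) : R :=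
  (1 - 21 * (6 * i) ^ 2 * ω) * (33 * i) ^ 5 * (22 * i) ^ 3

variable {R : Type*} [CommRing R] {i ω : R}

theorem map_sexticArg {S : Type*} [CommRing S] (f : R →+* S) :
    f (sexticArg i ω) = sexticArg (f i) (f ω) := by
  simp [sexticArg, map_ofNat]

/-- From `1 - 1728y(1 - 432y) = (1 - 864y)²`, the equation amounts to `1 - 1728/66³ = (21√33/121)²`.
-/
theorem sexticArg_mul (hi : 66 * i = 1) (hω : ω ^ 2 = 33) :
    sexticArg i ω * (1 - 432 * sexticArg i ω) = i ^ 3 := by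
  obtain ⟨t, ht⟩ : ∃ t, t = 33 * i := ⟨_, rfl⟩
  obtain ⟨j, hj⟩ : ∃ j, j = 22 * i := ⟨_, rfl⟩
  obtain ⟨e, he⟩ : ∃ e, e = 6 * i := ⟨_, rfl⟩
  have h2 : 2 * t = 1 := by rw [ht]; linear_combination hi
  have h3 : 3 * j = 1 := by rw [hj]; linear_combination hi
  obtain ⟨w, hw⟩ : ∃ w, w = t ^ 5 * j ^ 3 := ⟨_, rfl⟩
  have hw1 : 864 * w = 1 := by
    calc 864 * w = (2 * t) ^ 5 * (3 * j) ^ 3 := by rw [hw]; ring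
      _ = 1 := by rw [h2, h3]; ring
  have hy : sexticArg i ω = (1 - 21 * e ^ 2 * ω) * w := by
    rw [sexticArg, ← ht, ← hj, ← he, hw]; ring
  have h4 : 18974736 * i ^ 4 = 1 := by
    calc 18974736 * i ^ 4 = (66 * i) ^ 4 := by ring
      _ = 1 := by rw [hi]; ring
  have hmul : 1728 * (sexticArg i ω * (1 - 432 * sexticArg i ω)) = 1728 * i ^ 3 := by
    have h864 : 864 * sexticArg i ω = 1 - 21 * e ^ 2 * ω := by
      rw [hy]; linear_combination (1 - 21 * e ^ 2 * ω) * hw1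
    calc 1728 * (sexticArg i ω * (1 - 432 * sexticArg i ω))
        = 1 - (1 - 864 * sexticArg i ω) ^ 2 := by ring
      _ = 1 - 571536 * i ^ 4 * ω ^ 2 := by rw [h864, he]; ring
      _ = 1728 * i ^ 3 := by
        rw [hω]; linear_combination (-1 : R) * h4 + 1728 * i ^ 3 * hi
  -- In a general ring 1728 is cancelled through an explicit inverse.
  have hu : 1728 * (w * t) = 1 := by
    calc 1728 * (w * t) = (864 * w) * (2 * t) := by ring
      _ = 1 := by rw [hw1, h2, one_mul]
  calc _ = (1728 * (w * t)) * (sexticArg i ω * (1 - 432 * sexticArg i ω)) := by rw [hu, one_mul]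
    _ = (w * t) * (1728 * i ^ 3) := by rw [← hmul]; ring
    _ = (1728 * (w * t)) * i ^ 3 := by ring
    _ = i ^ 3 := by rw [hu, one_mul]

theorem sexticArg_constantTerm (hi : 66 * i = 1) (hω : ω ^ 2 = 33) :
    14 - 2 * (22 * i * ω) ^ 3 = -64 * (3 * (22 * i * ω)) ^ 3 * sexticArg i ω := by
  obtain ⟨t, ht⟩ : ∃ t, t = 33 * i := ⟨_, rfl⟩
  obtain ⟨j, hj⟩ : ∃ j, j = 22 * i := ⟨_, rfl⟩
  obtain ⟨e, he⟩ : ∃ e, e = 6 * i := ⟨_, rfl⟩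
  have h2 : 2 * t = 1 := by rw [ht]; linear_combination hi
  have h3 : 3 * j = 1 := by rw [hj]; linear_combination hi
  have h11 : 11 * e = 1 := by rw [he]; linear_combination hi
  have hjω : 3 * (22 * i * ω) = ω := by linear_combination ω * hi
  rw [hjω, sexticArg, ← ht, ← hj, ← he]
  have h4 : ω ^ 4 = 1089 := by
    calc ω ^ 4 = (ω ^ 2) ^ 2 := by ring
      _ = 1089 := by rw [hω]; norm_num
  symm
  calc -64 * ω ^ 3 * ((1 - 21 * e ^ 2 * ω) * t ^ 5 * j ^ 3)
      = -2 * (2 * t) ^ 5 * j ^ 3 * ω ^ 3 + 42 * (2 * t) ^ 5 * e ^ 2 * j ^ 3 * ω ^ 4 := by ring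
    _ = -2 * j ^ 3 * ω ^ 3 + 14 * (3 * j) ^ 3 * (11 * e) ^ 2 := by
        rw [h2, h4]; ring
    _ = 14 - 2 * (j * ω) ^ 3 := by rw [h3, h11]; ring

end QuadraticExtension

/-! ### Evaluation of the sum modulo `p²` and modulo `p`. -/

section Evaluation

variable {p : ℕ}

theorem coprime_sixtySix (hp : p.Prime) (hp2 : p ≠ 2) (hp3 : p ≠ 3) (hp11 : p ≠ 11) :
    Nat.Coprime 66 p := by
  rw [show 66 = 2 * 3 * 11 by norm_num]
  have h (q : ℕ) (hq : q.Prime) (hne : p ≠ q) : Nat.Coprime q p :=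
    (Nat.coprime_primes hq hp).2 hne.symm
  exact ((h 2 Nat.prime_two hp2).mul_left (h 3 Nat.prime_three hp3)).mul_left
    (h 11 (by norm_num) hp11)

theorem algebraMap_sum_sexticSqCoeff (hp : p.Prime) (hp2 : p ≠ 2) (hp3 : p ≠ 3)
    {A : Type*} [CommRing A] (hA : (p : A) ^ 2 = 0) {i : A} (hi : 66 * i = 1)
    {R : Type*} [CommRing R] [Algebra A R] {ω : R} (hω : ω ^ 2 = 33) :
    algebraMap A R (∑ k ∈ range p, (sexticSqCoeff k : A) * i ^ (3 * k)) =
      (∑ k ∈ range p, (sexticCoeff k : R) * sexticArg (algebraMap A R i) ω ^ k) ^ 2 := by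
  have hR : (p : R) ^ 2 = 0 := by
    rw [← map_natCast (algebraMap A R), ← map_pow, hA, map_zero]
  have hi' : 66 * algebraMap A R i = 1 := by
    rw [← map_ofNat (algebraMap A R), ← map_mul, hi, map_one]
  rw [← sum_sexticSqCoeff_eq_sq hp hp2 hp3 hR, sexticArg_mul hi' hω, map_sum]
  refine sum_congr rfl fun k _ => ?_
  rw [map_mul, map_intCast, pow_mul, map_pow, map_pow]

theorem pow_mul_sum_sexticCoeff [Fact p.Prime] (hp2 : p ≠ 2) (hp3 : p ≠ 3) {m : ℕ}
    (hm : p = 2 * m + 1) {K : Type*} [CommRing K] [Algebra (ZMod p) K] {i ω : K}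
    (hi : 66 * i = 1) (hω : ω ^ 2 = 33) :
    ω ^ m * ∑ k ∈ range p, (sexticCoeff k : K) * sexticArg i ω ^ k =
      -algebraMap (ZMod p) K (jacobsthalSum (1 : ZMod p) : ZMod p) := by
  have hl : 3 * (22 * i * ω) ^ 2 = 11 := by
    calc 3 * (22 * i * ω) ^ 2 = 1452 * i ^ 2 * ω ^ 2 := by ring
      _ = 11 * (66 * i) ^ 2 := by rw [hω]; ring
      _ = 11 := by rw [hi]; ring
  have h := coeff_pow_eq_mul_sum hp2 hp3 hm hl (sexticArg_constantTerm hi hω)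
  rw [show 3 * (22 * i * ω) = ω by linear_combination ω * hi] at h
  have hf : (X ^ 3 - 11 * X + 14 : (ZMod p)[X]).natDegree ≤ 3 := by compute_degree
  have hm0 : m ≠ 0 := by
    have := (Fact.out : p.Prime).two_le
    omega
  have hc := ZMod.coeff_pow_eq_neg_sum_quadraticChar hm hm0 hf
  have hF : ringChar (ZMod p) ≠ 2 := by rwa [ZMod.ringChar_zmod_n]
  simp only [eval_add, eval_sub, eval_mul, eval_pow, eval_X, eval_ofNat,
    sum_quadraticChar_eq_jacobsthalSum hF] at hc
  rw [← h, ← map_neg, ← hc, ← coeff_map]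
  simp

theorem sum_sexticSqCoeff_eq_zero (hp : p.Prime) (hp2 : p ≠ 2) (hp3 : p ≠ 3)
    (h4 : p % 4 = 3) {i : ZMod (p ^ 2)} (hi : 66 * i = 1) :
    ∑ k ∈ range p, (sexticSqCoeff k : ZMod (p ^ 2)) * i ^ (3 * k) = 0 := by
  have : Fact p.Prime := ⟨hp⟩
  obtain ⟨m, hm⟩ : ∃ m, p = 2 * m + 1 := ⟨p / 2, by omega⟩
  let f : ZMod (p ^ 2) →+* ZMod p := ZMod.castHom (dvd_pow_self p two_ne_zero) (ZMod p)
  let φ : AdjoinSqrt (ZMod (p ^ 2)) →+* AdjoinSqrt (ZMod p) := AdjoinSqrt.map f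
  let ω := AdjoinSqrt.root (ZMod (p ^ 2))
  have hω : ω ^ 2 = 33 := AdjoinSqrt.root_sq
  have hω' : φ ω ^ 2 = 33 := by rw [← map_pow, hω, map_ofNat]
  have hA : (p : ZMod (p ^ 2)) ^ 2 = 0 := by exact_mod_cast CharP.cast_eq_zero (ZMod (p ^ 2)) (p ^ 2)
  have hS := algebraMap_sum_sexticSqCoeff hp hp2 hp3 hA hi (R := AdjoinSqrt (ZMod (p ^ 2))) hω
  set ι := algebraMap (ZMod (p ^ 2)) (AdjoinSqrt (ZMod (p ^ 2))) i
  have hι : 66 * ι = 1 := by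
    rw [← map_ofNat (algebraMap (ZMod (p ^ 2)) (AdjoinSqrt (ZMod (p ^ 2)))), ← map_mul, hi, map_one]
  have hι' : 66 * φ ι = 1 := by rw [← map_ofNat φ, ← map_mul, hι, map_one]
  set T : AdjoinSqrt (ZMod (p ^ 2)) := ∑ k ∈ range p, (sexticCoeff k : AdjoinSqrt (ZMod (p ^ 2))) * sexticArg ι ω ^ k with hT
  have hφT : φ T = ∑ k ∈ range p, (sexticCoeff k : AdjoinSqrt (ZMod p)) * sexticArg (φ ι) (φ ω) ^ k := by
    rw [hT, map_sum]
    refine sum_congr rfl fun k _ => ?_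
    rw [map_mul, map_intCast, map_pow, map_sexticArg]
  have hz := pow_mul_sum_sexticCoeff hp2 hp3 hm hι' hω'
  have hχ : quadraticChar (ZMod p) (-1) = -1 := by
    rw [quadraticChar_neg_one (by rwa [ZMod.ringChar_zmod_n]), ZMod.card,
      ZMod.χ₄_nat_three_mod_four h4]
  rw [← hφT, jacobsthalSum_eq_zero hχ, Int.cast_zero, map_zero, neg_zero] at hz
  have hunit : IsUnit (φ ω ^ m) := by
    apply IsUnit.pow
    refine IsUnit.of_mul_eq_one (φ ω * (2 * φ ι)) ?_
    calc φ ω * (φ ω * (2 * φ ι)) = φ ω ^ 2 * (2 * φ ι) := by ring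
      _ = 66 * φ ι := by rw [hω']; ring
      _ = 1 := hι'
  have hT0 : φ T = 0 := (hunit.mul_right_eq_zero).1 hz
  -- Vanishing modulo `p` makes both coordinates of `T` multiples of `p`, so `T²` is zero modulo
  -- `p²`.
  have hker : ∀ x : ZMod (p ^ 2), f x = 0 → ∃ u, x = p * u := by
    intro x hx
    have : NeZero (p ^ 2) := ⟨pow_ne_zero 2 hp.ne_zero⟩
    rw [← ZMod.natCast_zmod_val x, map_natCast, ZMod.natCast_eq_zero_iff] at hx
    obtain ⟨u, hu⟩ := hx
    exact ⟨u, by rw [← ZMod.natCast_zmod_val x, hu]; push_cast; rfl⟩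
  obtain ⟨u, hu⟩ := hker T.re (congrArg QuadraticAlgebra.re hT0)
  obtain ⟨v, hv⟩ := hker T.im (congrArg QuadraticAlgebra.im hT0)
  have hTp : T = (p : AdjoinSqrt (ZMod (p ^ 2))) * ⟨u, v⟩ := by
    rw [AdjoinSqrt.natCast_mul_mk]
    ext
    · exact hu
    · exact hv
  have hR : (p : AdjoinSqrt (ZMod (p ^ 2))) ^ 2 = 0 := by
    rw [← map_natCast (algebraMap (ZMod (p ^ 2)) (AdjoinSqrt (ZMod (p ^ 2)))), ← map_pow, hA, map_zero]
  rw [hTp, mul_pow, hR, zero_mul] at hS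
  exact QuadraticAlgebra.algebraMap_injective (hS.trans (map_zero _).symm)

theorem sum_sexticSqCoeff_eq_mul_sq (hp : p.Prime) (hp3 : p ≠ 3) (h4 : p % 4 = 1)
    {a b : ℤ} (hab : (p : ℤ) = a ^ 2 + b ^ 2) (ha : ¬ 2 ∣ a) {i : ZMod p} (hi : 66 * i = 1) :
    ∑ k ∈ range p, (sexticSqCoeff k : ZMod p) * i ^ (3 * k) =
      ((jacobiSym p 33 * (4 * a ^ 2) : ℤ) : ZMod p) := by
  have : Fact p.Prime := ⟨hp⟩
  have hp2 : p ≠ 2 := by omega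
  obtain ⟨m, hm⟩ : ∃ m, p = 2 * m + 1 := ⟨p / 2, by omega⟩
  let ω := AdjoinSqrt.root (ZMod p)
  have hω : ω ^ 2 = 33 := AdjoinSqrt.root_sq
  have hA : (p : ZMod p) ^ 2 = 0 := by rw [CharP.cast_eq_zero, zero_pow two_ne_zero]
  have hS := algebraMap_sum_sexticSqCoeff hp hp2 hp3 hA hi (R := AdjoinSqrt (ZMod p)) hω
  set S := ∑ k ∈ range p, (sexticSqCoeff k : ZMod p) * i ^ (3 * k)
  have hι : 66 * algebraMap (ZMod p) (AdjoinSqrt (ZMod p)) i = 1 := by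
    rw [← map_ofNat (algebraMap (ZMod p) (AdjoinSqrt (ZMod p))), ← map_mul, hi, map_one]
  have hz := pow_mul_sum_sexticCoeff hp2 hp3 hm hι hω
  have hSm : 33 ^ m * S = (4 * a ^ 2 : ZMod p) := by
    have hJ := congrArg (Int.cast : ℤ → ZMod p) (jacobsthalSum_sq_eq h4 hab ha)
    push_cast at hJ
    rw [← hJ]
    apply QuadraticAlgebra.algebraMap_injective (a := (33 : ZMod p)) (b := 0)
    rw [map_mul, map_pow, map_pow, map_ofNat, hS, ← hω, ← pow_mul, mul_comm 2 m, pow_mul, ← mul_pow,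
      hz, neg_sq]
  -- Reciprocity has no sign because `33 ≡ 1 (mod 4)`; Euler's criterion gives the power.
  have hjac : ((jacobiSym p 33 : ℤ) : ZMod p) = 33 ^ m := by
    rw [← jacobiSym.quadratic_reciprocity_one_mod_four (a := 33) (b := p) (by norm_num)
      (hp.odd_of_ne_two hp2), ← jacobiSym.legendreSym.to_jacobiSym, legendreSym.eq_pow]
    push_cast
    congr 1
    omega
  have h33 : (33 : ZMod p) ≠ 0 := by
    intro h
    have : (66 : ZMod p) * i = 0 := by linear_combination 2 * i * h
    rw [hi] at this
    exact one_ne_zero this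
  have h1 : (33 ^ m * 33 ^ m : ZMod p) = 1 := by
    rw [← pow_add, ← ZMod.pow_card_sub_one_eq_one h33]
    congr 1
    omega
  push_cast
  rw [hjac]
  linear_combination 33 ^ m * hSm - S * h1

theorem ratModEq_sum {n N : ℕ} (hn : Nat.Coprime 66 n) {i : ZMod n} (hi : 66 * i = 1) (r : ℤ)
    (h : ∑ k ∈ range N, (sexticSqCoeff k : ZMod n) * i ^ (3 * k) = (r : ZMod n)) :
    RatModEq n
      (∑ k ∈ range N, ((Nat.choose (2 * k) k : ℚ) * (Nat.choose (3 * k) k : ℚ) *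
        (Nat.choose (6 * k) (3 * k) : ℚ)) / (66 : ℚ) ^ (3 * k)) r := by
  -- Clear denominators with `66 ^ (3N)`, which is coprime to `n`.
  have hint : ((∑ k ∈ range N, sexticSqCoeff k * 66 ^ (3 * N - 3 * k) - 66 ^ (3 * N) * r : ℤ) :
      ZMod n) = 0 := by
    push_cast
    rw [← h, mul_sum, sub_eq_zero]
    refine sum_congr rfl fun k hk => ?_
    rw [mem_range] at hk
    have hpow : (66 : ZMod n) ^ (3 * N) = 66 ^ (3 * N - 3 * k) * 66 ^ (3 * k) := by
      rw [← pow_add]; congr 1; omega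
    have hone : (66 : ZMod n) ^ (3 * k) * i ^ (3 * k) = 1 := by rw [← mul_pow, hi, one_pow]
    rw [hpow]
    linear_combination (-(sexticSqCoeff k : ZMod n)) * 66 ^ (3 * N - 3 * k) * hone
  rw [ZMod.intCast_zmod_eq_zero_iff_dvd] at hint
  obtain ⟨w, hw⟩ := hint
  refine ⟨(w : ℚ) / ((66 ^ (3 * N) : ℤ) : ℚ), ?_, ?_⟩
  · have hd : (((w : ℚ) / ((66 ^ (3 * N) : ℤ) : ℚ)).den : ℤ) ∣ 66 ^ (3 * N) := by
      rw [← Rat.divInt_eq_div]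
      exact Rat.den_dvd _ _
    have hd' : ((w : ℚ) / ((66 ^ (3 * N) : ℤ) : ℚ)).den ∣ 66 ^ (3 * N) := by exact_mod_cast hd
    exact Nat.Coprime.coprime_dvd_left hd' (hn.pow_left _)
  · have hw' := congrArg (Int.cast : ℤ → ℚ) hw
    push_cast at hw' ⊢
    have hsum : ∑ k ∈ range N, ((Nat.choose (2 * k) k : ℚ) * (Nat.choose (3 * k) k : ℚ) *
        (Nat.choose (6 * k) (3 * k) : ℚ)) / (66 : ℚ) ^ (3 * k) =
        (∑ k ∈ range N, (sexticSqCoeff k : ℚ) * 66 ^ (3 * N - 3 * k)) / 66 ^ (3 * N) := by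
      rw [sum_div]
      refine sum_congr rfl fun k hk => ?_
      rw [mem_range] at hk
      have hpow : (66 : ℚ) ^ (3 * N) = 66 ^ (3 * N - 3 * k) * 66 ^ (3 * k) := by
        rw [← pow_add]; congr 1; omega
      rw [hpow, sexticSqCoeff]
      push_cast
      field_simp
    rw [hsum, ← mul_div_assoc, ← hw']
    field_simp

end Evaluation

theorem theorem4p10 (p : ℕ) (hp : p.Prime) (hp2 : p ≠ 2) (hp3 : p ≠ 3) (hp11 : p ≠ 11) :
    (p ≡ 3 [MOD 4] →
      RatModEq (p ^ 2)
        (∑ k ∈ Finset.range p,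
          ((Nat.choose (2 * k) k : ℚ) * (Nat.choose (3 * k) k : ℚ) *
            (Nat.choose (6 * k) (3 * k) : ℚ)) / (66 : ℚ) ^ (3 * k))
        0) ∧
    (∀ a b : ℤ, (p : ℤ) = a ^ 2 + b ^ 2 → p ≡ 1 [MOD 4] → ¬ (2 ∣ a) →
      RatModEq p
        (∑ k ∈ Finset.range p,
          ((Nat.choose (2 * k) k : ℚ) * (Nat.choose (3 * k) k : ℚ) *
            (Nat.choose (6 * k) (3 * k) : ℚ)) / (66 : ℚ) ^ (3 * k))
        ((jacobiSym (p : ℤ) 33 : ℚ) * (4 * (a : ℚ) ^ 2))) := by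
  have hc := coprime_sixtySix hp hp2 hp3 hp11
  constructor
  · intro h4
    have hc2 : Nat.Coprime 66 (p ^ 2) := hc.pow_right 2
    have hi : (66 : ZMod (p ^ 2)) * 66⁻¹ = 1 := by exact_mod_cast ZMod.coe_mul_inv_eq_one 66 hc2
    have := ratModEq_sum hc2 hi 0
      ((sum_sexticSqCoeff_eq_zero hp hp2 hp3 h4 hi).trans Int.cast_zero.symm)
    rwa [Int.cast_zero] at this
  · intro a b hab h4 ha
    have hi : (66 : ZMod p) * 66⁻¹ = 1 := by exact_mod_cast ZMod.coe_mul_inv_eq_one 66 hc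
    have := ratModEq_sum hc hi _ (sum_sexticSqCoeff_eq_mul_sq hp hp3 h4 hab ha hi)
    push_cast at this
    exact this
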